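/- Let $\Gamma := \{3\}\cup\bigcup_{k=1}^\infty\{k^2+1,k^2+2,\dots,k^2+k\}$. For an integer $b\ge 2$, a number $x\in(0,1)$ is called a Trott number in base $b$ if it has an infinite continued fraction expansion $x=[0;a_1,a_2,a_3,\dots]$ with positive integers $a_i$ such that also $x=(0.\hat a_1\hat a_2\hat a_3\dots)_b$, where $\hat a_i$ is the string of digits resulting from writing $a_i$ in base $b$. Let $T_b\subset\mathbb{R}$ denote the set of all Trott numbers in base $b$. Theorem. For each $b\in\Gamma$, $T_b$ is a complete $G_\delta$ set; that is, $T_b$ is $G_\delta$, and every $G_\delta$ subset $B$ of a zero-dimensional Polish space $Y$ is of the form $B=f^{-1}(T_b)$ for some continuous map $f:Y\to\mathbb{R}$. In particular, $T_b$ is $G_\delta$ but not $F_\sigma$. -/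

import Mathlib

open Filter Topology

/-- The set `Γ = {3} ∪ ⋃_{k ≥ 1} {k² + 1, k² + 2, …, k² + k}` of bases. -/
def Gam : Set ℕ := {3} ∪ ⋃ k ∈ Set.Ici 1, Set.Icc (k ^ 2 + 1) (k ^ 2 + k)

/-- The infinite simple continued fraction `[0; a 0, a 1, a 2, …]`. -/
noncomputable def infContFract (a : ℕ → ℕ) : GenContFract ℝ where
  h := 0
  s := Stream'.Seq.ofStream fun n => ⟨1, (a n : ℝ)⟩

/-- `x` is the value of the infinite continued fraction `[0; a 0, a 1, a 2, …]` with positive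
integer partial quotients, that is, the limit of its convergents. -/
def IsInfContFractOf (a : ℕ → ℕ) (x : ℝ) : Prop :=
  (∀ n, 0 < a n) ∧ Tendsto (infContFract a).convs atTop (𝓝 x)

/-- The string of base `b` digits of `m`, most significant digit first. -/
def digitString (b m : ℕ) : List ℕ := (Nat.digits b m).reverse

/-- The concatenation of the base `b` digit strings of `a 0, …, a (n - 1)`. -/
def concatPrefix (b : ℕ) (a : ℕ → ℕ) (n : ℕ) : List ℕ :=
  (List.range n).flatMap fun i => digitString b (a i)

/-- The entry with index `k` (counting from `0`) of the infinite concatenation of the digit strings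
of `a 0, a 1, a 2, …`. If all `a i` are positive then each string is non-empty, so the entry is
already present in the concatenation of the first `k + 1` strings. -/
def concatDigit (b : ℕ) (a : ℕ → ℕ) (k : ℕ) : ℕ := (concatPrefix b a (k + 1)).getD k 0

/-- `x = (0.d₀ d₁ d₂ …)_b`, where `d₀ d₁ d₂ …` is the infinite concatenation of the base `b` digit
strings of `a 0, a 1, a 2, …`. -/
def IsConcatExpansionOf (b : ℕ) (a : ℕ → ℕ) (x : ℝ) : Prop :=
  ∃ d : ℕ → Fin b, (∀ k, (d k : ℕ) = concatDigit b a k) ∧ x = Real.ofDigits d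

/-- `x` is a Trott number in base `b`. -/
def IsTrott (b : ℕ) (x : ℝ) : Prop :=
  ∃ a : ℕ → ℕ, IsInfContFractOf a x ∧ IsConcatExpansionOf b a x

/-- The set `T_b` of all Trott numbers in base `b`. -/
def trottSet (b : ℕ) : Set ℝ := {x | IsTrott b x}

/-- An `F_σ` set: a countable union of closed sets. -/
def IsFSigma {X : Type*} [TopologicalSpace X] (A : Set X) : Prop :=
  ∃ F : ℕ → Set X, (∀ n, IsClosed (F n)) ∧ A = ⋃ n, F n

/-- A complete `G_δ` set: it is `G_δ`, and every `G_δ` subset `B` of a zero-dimensional Polish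
space `Y` is the preimage of `A` under a continuous map. (Every Polish space is homeomorphic to one
in the lowest universe.) -/
def IsCompleteGDelta {X : Type*} [TopologicalSpace X] (A : Set X) : Prop :=
  IsGδ A ∧
    ∀ (Y : Type) [TopologicalSpace Y] [PolishSpace Y],
      TopologicalSpace.IsTopologicalBasis {s : Set Y | IsClopen s} →
      ∀ B : Set Y, IsGδ B → ∃ f : Y → X, Continuous f ∧ f ⁻¹' A = B

/-! Let a finite prefix have last denominators `q`, `r` and `N` digits, with last convergent at
relative position `w / q` in the `b`-adic interval of these digits. A next quotient `a` with `n`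
digits should be close to `(w / q) b^n`; write `a q = w b^n - η`. The new denominator is `q' = w b^n
+ (r - η)`, the new position satisfies `w' q = σ b^(N+n) + q' η`, and so `w' / q'` tends to `(η w +
σ b^N) / (q w)` as `n` grows. This limit has to lie between `1 / b` and `1`, so that the following
quotient again has the right number of digits. The only constraint on `η` is `η ≡ w b^n` mod `q`, so
what is needed is a residue in a suitable window that recurs for infinitely many `n`. `Extendable`
records this, and `Extendable.exists_next` shows that it propagates. The set `Gam` serves only to
provide a first prefix (`exists_goodPrefix`).

Good prefixes thus form an infinitely branching tree. The children of a node converge to its last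
convergent, which is rational and hence not Trott, while every infinite branch converges to a Trott
number. `isCompleteGDelta_of_scheme` turns such a tree into reductions of arbitrary `G_δ` sets. The
set itself is `G_δ` because partial quotients are continuous on the irrationals, where being Trott
is a closed condition within `(0, 1)`. It is not `F_σ` by Baire category. -/

theorem Int.dvd_of_dvd_pow_of_dvd_mul_pow_add {b d w h : ℤ} {n M : ℕ} (hh : h ≠ 0)
    (hn : h.natAbs ≤ n) (hd : d ∣ b ^ M) (hdw : d ∣ w * b ^ n + h) : d ∣ h := by
  rw [← Int.natAbs_dvd_natAbs, Nat.dvd_iff_prime_pow_dvd_dvd]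
  intro p k hp hpk
  have hpd : ((p ^ k : ℕ) : ℤ) ∣ d := Int.natCast_dvd.2 hpk
  rcases Nat.eq_zero_or_pos k with rfl | hk
  · simp
  have hpb : (p : ℤ) ∣ b := by
    refine Int.Prime.dvd_pow' (n := b) (k := M) hp ?_
    refine dvd_trans ?_ (hpd.trans hd)
    exact_mod_cast dvd_pow_self p hk.ne'
  have key : ∀ i, i ≤ k → i ≤ n → ((p ^ i : ℕ) : ℤ) ∣ h := by
    intro i hik hin
    have h1 : ((p ^ i : ℕ) : ℤ) ∣ w * b ^ n + h :=
      (Int.natCast_dvd_natCast.2 (pow_dvd_pow p hik)).trans (hpd.trans hdw)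
    have h2 : ((p ^ i : ℕ) : ℤ) ∣ w * b ^ n := by
      push_cast
      exact ((pow_dvd_pow _ hin).trans (pow_dvd_pow_of_dvd hpb n)).mul_left w
    exact (Int.dvd_add_right h2).1 h1
  -- If `k > n`, then `p ^ n ∣ h`, although `0 < |h| ≤ n < p ^ n`.
  rcases le_total k n with hkn | hnk
  · exact Int.natCast_dvd.1 (key k le_rfl hkn)
  · exfalso
    have h1 := Nat.le_of_dvd (Int.natAbs_pos.2 hh) (Int.natCast_dvd.1 (key n hnk le_rfl))
    exact absurd (h1.trans hn) (not_le.2 (Nat.lt_pow_self hp.one_lt))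

/-! ### The orbit of `w` under multiplication by `b` modulo `q` -/

section Residues

variable {b q w B : ℤ}

theorem mul_pow_succ_emod (b q w : ℤ) (n : ℕ) :
    w * b ^ (n + 1) % q = b * (w * b ^ n % q) % q := by
  rw [pow_succ, ← mul_assoc, mul_comm _ b]
  exact ((Int.mod_modEq _ _).mul_left b).symm

/-- A residue below `q / b` is multiplied by exactly `b`, without reduction. The least `L` that
brings it above `q / b` works; hitting `q` exactly would produce the excluded residue `0`. -/
theorem exists_emod_growth (hb : 2 ≤ b) (hq : 0 < q) {n₀ : ℕ}
    (hpos : ∀ n ≥ n₀, 0 < w * b ^ n % q) {n : ℕ} (hn : n₀ ≤ n) :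
    ∃ L, w * b ^ (n + L) % q = b ^ L * (w * b ^ n % q) ∧
      q < b ^ (L + 1) * (w * b ^ n % q) := by
  have hex : ∃ L, q < b ^ (L + 1) * (w * b ^ n % q) := by
    obtain ⟨L, hL⟩ := pow_unbounded_of_one_lt q (show 1 < b by lia)
    refine ⟨L, ?_⟩
    have h1 := hpos n hn
    have h2 : b ^ L ≤ b ^ (L + 1) := pow_le_pow_right₀ (by lia) (by lia)
    have h3 : 0 < b ^ (L + 1) := by positivity
    nlinarith
  classical
  refine ⟨Nat.find hex, ?_, Nat.find_spec hex⟩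
  have hlt : ∀ i < Nat.find hex, b ^ (i + 1) * (w * b ^ n % q) ≤ q := fun i hi =>
    not_lt.1 (Nat.find_min hex hi)
  have key : ∀ i ≤ Nat.find hex, w * b ^ (n + i) % q = b ^ i * (w * b ^ n % q) := by
    intro i
    induction i with
    | zero => simp
    | succ i ih =>
      intro hi
      have h1 := ih (by lia)
      have h2 := hlt i (by lia)
      have h3 := hpos (n + i + 1) (by lia)
      have h4 : w * b ^ (n + i + 1) % q = b ^ (i + 1) * (w * b ^ n % q) % q := by
        rw [mul_pow_succ_emod, h1]
        ring_nf
      have h5 := hpos n hn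
      have h6 : b ^ (i + 1) * (w * b ^ n % q) ≠ q := by
        intro h
        rw [h4, h, Int.emod_self] at h3
        exact lt_irrefl _ h3
      rw [← add_assoc, h4]
      exact Int.emod_eq_of_lt (by positivity) (lt_of_le_of_ne h2 h6)
  exact key _ le_rfl

/-- A residue above `q / b` can fail only by lying within `B / w` of `q`. Its distance to `q` is
then multiplied by `b` at every step, yet would have to stay at most `B / w` forever. -/
theorem exists_emod_mid (hb : 2 ≤ b) (hq : 0 < q) (hw : 0 < w) (hB : 0 < B)
    (hnd : ∀ n, ¬ q ∣ w * b ^ n) (hsmall : b ^ 2 * B < q * w) (n₀ : ℕ) :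
    ∃ n ≥ n₀, q < b * (w * b ^ n % q) ∧ (w * b ^ n % q) * w + B < q * w := by
  by_contra! hcon
  have hpos : ∀ n ≥ n₀, 0 < w * b ^ n % q := fun n _ =>
    lt_of_le_of_ne (Int.emod_nonneg _ hq.ne') fun h => hnd n (Int.dvd_of_emod_eq_zero h.symm)
  obtain ⟨L, hL, hqL⟩ := exists_emod_growth hb hq hpos (le_refl n₀)
  have hstart := hcon (n₀ + L) (by lia) (by rw [hL, ← mul_assoc, ← pow_succ']; exact hqL)
  set z := q - w * b ^ (n₀ + L) % q with hz
  have hzpos : 0 < z := by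
    have := Int.emod_lt_of_pos (w * b ^ (n₀ + L)) hq
    lia
  have key : ∀ i, q - w * b ^ (n₀ + L + i) % q = b ^ i * z ∧ b ^ i * z * w ≤ B := by
    intro i
    induction i with
    | zero => exact ⟨by simp [hz], by rw [hz]; linarith⟩
    | succ i ih =>
      obtain ⟨h1, h2⟩ := ih
      have hy : 0 < b ^ i * z := by positivity
      set y := b ^ i * z with hyd
      have h3 : b ^ 2 * y < q := by
        refine lt_of_mul_lt_mul_right ?_ hw.le
        nlinarith [sq_nonneg b]
      have h4 : w * b ^ (n₀ + L + (i + 1)) % q = q - b * y := by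
        rw [← add_assoc, mul_pow_succ_emod, show w * b ^ (n₀ + L + i) % q = q - y by lia,
          show b * (q - y) = (q - b * y) + q * (b - 1) by ring, Int.add_mul_emod_self_left]
        refine Int.emod_eq_of_lt ?_ ?_ <;> nlinarith
      have h5 : b ^ (i + 1) * z = b * y := by rw [hyd]; ring
      refine ⟨by rw [h4, h5]; ring, ?_⟩
      have h6 := hcon (n₀ + L + (i + 1)) (by lia) (by rw [h4]; nlinarith)
      rw [h4] at h6
      rw [h5]
      linarith
  obtain ⟨i, hi⟩ := pow_unbounded_of_one_lt B (show 1 < b by lia)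
  have h1 := (key i).2
  have h2 : 0 < b ^ i := by positivity
  nlinarith [mul_pos hzpos hw]

/-- Residues never exceed `q / b + B / w`. Once growth passes `q / b`, the next factor `b`
overshoots `q` by at most `b B / w`, so the orbit falls back to a tiny residue `t`. -/
theorem exists_emod_return (hb : 2 ≤ b) (hq : 0 < q) (hw : 0 < w) (hB : 0 < B)
    (hsmall : b * B < q * w) {n₀ : ℕ}
    (hbad : ∀ n ≥ n₀, B ≤ (w * b ^ n % q) * w ∧ b * ((w * b ^ n % q) * w) ≤ q * w + b * B)
    {n : ℕ} (hn : n₀ ≤ n) :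
    ∃ L t, w * b ^ (n + L) % q = t ∧ b ^ L * (w * b ^ n % q) = q + t ∧ 0 < t ∧ t * w ≤ b * B := by
  have hpos : ∀ n ≥ n₀, 0 < w * b ^ n % q := fun n hn => by
    have := (hbad n hn).1
    exact pos_of_mul_pos_left (by linarith) hw.le
  obtain ⟨L, hL, hqL⟩ := exists_emod_growth hb hq hpos hn
  have h1 := (hbad (n + L) (by lia)).2
  rw [hL] at h1
  have h2 : b * (b ^ L * (w * b ^ n % q)) = b ^ (L + 1) * (w * b ^ n % q) := by ring
  set y := b ^ (L + 1) * (w * b ^ n % q) with hy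
  have h3 : y * w ≤ q * w + b * B := by rw [← h2]; linarith
  have h4 : y < 2 * q := by
    refine lt_of_mul_lt_mul_right ?_ hw.le
    linarith
  refine ⟨L + 1, y - q, ?_, by rw [← hy]; ring, by lia, by linarith⟩
  rw [← add_assoc, mul_pow_succ_emod, hL, h2, show y = (y - q) + q by ring, Int.add_emod_right]
  rw [add_sub_cancel_right]
  exact Int.emod_eq_of_lt (by lia) (by lia)

end Residues

/-! ### Extending a prefix by one large partial quotient -/

/-- The numerical data of a finite prefix of a potential Trott expansion in base `b`: `q` and `r`
are the last two denominators, `w / q` is the position of the last convergent in the current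
`b`-adic interval of length `b ^ (-N)`, and `σ` is the side from which the value of the continued
fraction approaches that convergent. The prefix can be continued by every large partial quotient
`a` with `a * q = w * b ^ n - η`. -/
structure Extendable (b σ q r w : ℤ) (N : ℕ) : Prop where
  q_pos : 0 < q
  w_pos : 0 < w
  lt_mul : q < b * w
  le : w ≤ q
  exists_shift : ∃ η : ℤ, η ≠ 0 ∧ η ≠ r ∧ q * w < b * (η * w + σ * b ^ N) ∧
    (η * w + σ * b ^ N < q * w ∨ (η * w + σ * b ^ N = q * w ∧ 0 < σ * (r - η))) ∧
    (w < q ∨ 0 < η) ∧ (σ = 1 → η < r ∨ ∀ M : ℕ, ¬ w ∣ b ^ M) ∧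
    ∃ᶠ n : ℕ in atTop, q ∣ w * b ^ n - η

/-- With `P = b ^ n` the conclusion says that `a` has exactly `n` digits. It holds because `a / P`
is close to `w / q ∈ (1 / b, 1]`; if `w = q`, the sign of `η` keeps `a` below `P`. -/
theorem partial_quotient_bounds {b q w η P a : ℤ} (hb : 2 ≤ b) (hq : 0 < q)
    (hqw : q < b * w) (hwq : w ≤ q) (hη : w < q ∨ 0 < η) (hP₁ : b * |η| < P)
    (ha : a * q = w * P - η) : P ≤ b * a ∧ a < P := by
  have hPpos : 0 < P := lt_of_le_of_lt (by positivity) hP₁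
  have e1 := neg_abs_le η
  have e2 := le_abs_self η
  have e3 : |η| ≤ b * |η| := le_mul_of_one_le_left (abs_nonneg _) (by lia)
  have e4 : b * η ≤ b * |η| := mul_le_mul_of_nonneg_left e2 (by lia)
  have h1 : P ≤ b * a := by
    refine le_of_mul_le_mul_right ?_ hq
    rw [mul_assoc, ha]
    have : P * 1 ≤ P * (b * w - q) := mul_le_mul_of_nonneg_left (by lia) hPpos.le
    linarith
  have h2 : a < P := by
    refine lt_of_mul_lt_mul_right ?_ hq.le
    rw [ha]
    rcases hη with h | h
    · have : P * 1 ≤ P * (q - w) := mul_le_mul_of_nonneg_left (by lia) hPpos.le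
      linarith
    · have : P * w ≤ P * q := mul_le_mul_of_nonneg_left hwq hPpos.le
      linarith
  exact ⟨h1, h2⟩

/-- Inequalities satisfied by the data of the extended prefix when the new partial quotient is
large. -/
theorem next_bounds {b σ q r w η P B q' w' : ℤ} (hb : 2 ≤ b) (hσ : σ = 1 ∨ σ = -1)
    (hq : 0 < q) (hw : 0 < w) (hB : 0 < B)
    (hu : q * w < b * (η * w + σ * B))
    (hu' : η * w + σ * B < q * w ∨ (η * w + σ * B = q * w ∧ 0 < σ * (r - η)))
    (hP₂ : b * |η * (r - η)| + |q * (r - η)| < P)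
    (hP₃ : 2 * |r - η| + 2 * b * q < P) (hP₄ : 4 * b ^ 3 * B < P)
    (hq' : q' = w * P + (r - η)) (hw' : w' * q = (η * w + σ * B) * P + η * (r - η)) :
    q' < b * w' ∧ w' < q' ∧ b * q < q' ∧ b ^ 2 * (B * P) < q' * w' ∧ P < 2 * q' := by
  obtain ⟨h, hh⟩ : ∃ h, h = r - η := ⟨_, rfl⟩
  obtain ⟨u, hud⟩ : ∃ u, u = η * w + σ * B := ⟨_, rfl⟩
  rw [← hh] at hu' hP₂ hP₃ hq' hw'
  rw [← hud] at hu hu' hw'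
  have hPpos : 0 < P := lt_of_le_of_lt (by positivity) hP₄
  have f1 := neg_abs_le h
  have f2 := le_abs_self h
  have f3 : P * 1 ≤ P * w := mul_le_mul_of_nonneg_left hw hPpos.le
  have f4 : 0 < b * q := mul_pos (by lia) hq
  have h7 : P < 2 * q' := by linarith
  have g1 := neg_abs_le (η * h)
  have g2 := le_abs_self (η * h)
  have g3 := neg_abs_le (q * h)
  have g4 := le_abs_self (q * h)
  have g5 : |η * h| ≤ b * |η * h| := le_mul_of_one_le_left (abs_nonneg _) (by lia)
  have g6 : b * -|η * h| ≤ b * (η * h) := mul_le_mul_of_nonneg_left g1 (by lia)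
  have h3 : q' < b * w' := by
    refine lt_of_mul_lt_mul_right ?_ hq.le
    rw [mul_assoc, hw', hq']
    have : P * 1 ≤ P * (b * u - q * w) := mul_le_mul_of_nonneg_left (by lia) hPpos.le
    linarith
  have h4 : w' < q' := by
    refine lt_of_mul_lt_mul_right ?_ hq.le
    rw [hw', hq']
    rcases hu' with h' | ⟨h', hs⟩
    · have : P * 1 ≤ P * (q * w - u) := mul_le_mul_of_nonneg_left (by lia) hPpos.le
      linarith
    -- In the boundary case the terms of order `P` cancel and the sign of `(q - η) * h` decides; `q
    -- - η` has the sign of `σ`.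
    · rw [h']
      suffices 0 < (q - η) * h by linarith
      have h9 : (q - η) * w = σ * B := by linarith
      rcases hσ with rfl | rfl
      · have h8 : 0 < q - η := by
          refine pos_of_mul_pos_left ?_ hw.le
          linarith
        exact mul_pos h8 (by linarith)
      · have h8 : q - η < 0 := by
          by_contra! hc
          have := mul_nonneg hc hw.le
          linarith
        exact mul_pos_of_neg_of_neg h8 (by linarith)
  have h5 : b * q < q' := by linarith
  -- From `q' > P / 2` and `w' > P / (2 b)` follows `q' w' > P² / (4 b)`; the threshold `4 b³ B < P`
  -- is chosen for this.
  refine ⟨h3, h4, h5, ?_, h7⟩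
  have h8 : P < 2 * (b * w') := by linarith
  have h9 : P * P < (2 * q') * (2 * (b * w')) := mul_lt_mul'' h7 h8 hPpos.le hPpos.le
  have h10 : (4 * b ^ 3 * B) * P < P * P := mul_lt_mul_of_pos_right hP₄ hPpos
  have h11 : (4 * b) * (b ^ 2 * (B * P)) < (4 * b) * (q' * w') := by linarith
  exact lt_of_mul_lt_mul_left h11 (by lia)

/-- Pigeonhole: one of the finitely many shifts in `s` must serve infinitely many `n`. -/
theorem frequently_dvd_sub_of_frequently {b q w : ℤ} {p : ℤ → Prop} {s : Finset ℤ}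
    (h : ∀ n₀ : ℕ, ∃ n ≥ n₀, ∃ η ∈ s, p η ∧ q ∣ w * b ^ n - η) :
    ∃ η, p η ∧ ∃ᶠ n : ℕ in atTop, q ∣ w * b ^ n - η := by
  have h' : ∃ᶠ n : ℕ in atTop, ∃ η ∈ s, p η ∧ q ∣ w * b ^ n - η := frequently_atTop.2 h
  rw [frequently_exists_finset] at h'
  obtain ⟨η, -, hη⟩ := h'
  exact ⟨η, (hη.exists.choose_spec).1, hη.mono fun n hn => hn.2⟩

theorem eventually_lt_pow {b : ℤ} (hb : 2 ≤ b) (X : ℤ) : ∀ᶠ n : ℕ in atTop, X < b ^ n :=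
  (tendsto_pow_atTop_atTop_of_one_lt (show 1 < b by lia)).eventually_gt_atTop X

theorem exists_shift_of_pos {b q r w B : ℤ} (hb : 2 ≤ b) (hq : 0 < q) (hw : 0 < w) (hB : 0 < B)
    (hr : b * r < q) (hr₀ : 0 < r) (hnd : ∀ n, ¬ q ∣ w * b ^ n) (hsmall : b ^ 2 * B < q * w) :
    ∃ η : ℤ, (0 < η ∧ r < η ∧ q * w < b * (η * w + B) ∧ η * w + B < q * w) ∧
      ∃ᶠ n : ℕ in atTop, q ∣ w * b ^ n - η := by
  refine frequently_dvd_sub_of_frequently (s := Finset.Icc 0 q) fun n₀ => ?_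
  obtain ⟨n, hn, h1, h2⟩ := exists_emod_mid hb hq hw hB hnd hsmall n₀
  have h3 : r < w * b ^ n % q := lt_of_mul_lt_mul_left (hr.trans h1) (by lia)
  refine ⟨n, hn, w * b ^ n % q, ?_, ⟨hr₀.trans h3, h3, ?_, h2⟩, Int.dvd_self_sub_emod⟩
  · rw [Finset.mem_Icc]
    exact ⟨Int.emod_nonneg _ hq.ne', (Int.emod_lt_of_pos _ hq).le⟩
  · have h4 := mul_lt_mul_of_pos_right h1 hw
    have h5 : 0 < b * B := mul_pos (by lia) hB
    linarith

/-- On the side `σ = -1` the window is `q / b + B / w < η < q + B / w`. An orbit that eventually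
avoids it must keep returning to tiny residues, which gives the second alternative. -/
theorem exists_shift_or_return {b q r w B : ℤ} (hb : 2 ≤ b) (hq : 0 < q) (hw : 0 < w)
    (hB : 0 < B) (hr : b * r < q) (hr₀ : 0 < r) (hsmall : b ^ 2 * B < q * w) :
    (∃ η : ℤ, (0 < η ∧ r < η ∧ q * w < b * (η * w - B) ∧ η * w - B < q * w) ∧
      ∃ᶠ n : ℕ in atTop, q ∣ w * b ^ n - η) ∨
    ∃ n L₁ L₂ t₁ t₂ t₃, w * b ^ n % q = t₂ ∧ b ^ L₁ * t₁ = q + t₂ ∧ b ^ L₂ * t₂ = q + t₃ ∧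
      (0 < t₁ ∧ t₁ * w ≤ b * B) ∧ (0 < t₂ ∧ t₂ * w ≤ b * B) ∧ 0 < t₃ ∧ t₃ * w ≤ b * B := by
  have hbB : b * B < q * w := by
    have h1 : 0 < b * B := mul_pos (by lia) hB
    have h2 : 1 * (b * B) ≤ b * (b * B) := mul_le_mul_of_nonneg_right (by lia) h1.le
    linarith
  have hη : ∀ η, q * w < b * (η * w - B) → 0 < η ∧ r < η := by
    intro η h
    have h1 : 0 < b * B := mul_pos (by lia) hB
    have h2 : q < b * η := by
      refine lt_of_mul_lt_mul_right ?_ hw.le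
      linarith
    have h3 : r < η := lt_of_mul_lt_mul_left (hr.trans h2) (by lia)
    exact ⟨hr₀.trans h3, h3⟩
  by_cases hcon : ∀ n₀ : ℕ, ∃ n ≥ n₀, ∃ η ∈ Finset.Icc 0 (2 * q),
      (0 < η ∧ r < η ∧ q * w < b * (η * w - B) ∧ η * w - B < q * w) ∧ q ∣ w * b ^ n - η
  · exact Or.inl (frequently_dvd_sub_of_frequently hcon)
  right
  obtain ⟨n₀, h₀⟩ := not_forall.1 hcon
  have hbad : ∀ n ≥ n₀, B ≤ (w * b ^ n % q) * w ∧ b * ((w * b ^ n % q) * w) ≤ q * w + b * B := by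
    intro n hn
    have hlt := Int.emod_lt_of_pos (w * b ^ n) hq
    have hnn := Int.emod_nonneg (w * b ^ n) hq.ne'
    have hlt' := mul_lt_mul_of_pos_right hlt hw
    have hdvd : q ∣ w * b ^ n - w * b ^ n % q := Int.dvd_self_sub_emod
    set R := w * b ^ n % q
    constructor
    · by_contra! hc
      -- A residue below `B / w` is usable after adding `q`, since the window reaches beyond `q`.
      refine h₀ ⟨n, hn, R + q, by rw [Finset.mem_Icc]; lia, ?_, ?_⟩
      · have h1 : q * w < b * ((R + q) * w - B) := by
          have h2 : 0 ≤ b * (R * w) := mul_nonneg (by lia) (mul_nonneg hnn hw.le)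
          have h3 : b * (b * B) < b * (q * w) := mul_lt_mul_of_pos_left hbB (by lia)
          have h4 : 0 < q * w := mul_pos hq hw
          rcases eq_or_lt_of_le hb with rfl | hb'
          · linarith
          · have h5 : 0 ≤ (b - 3) * (q * w) := mul_nonneg (by lia) h4.le
            linarith
        obtain ⟨h2, h3⟩ := hη _ h1
        exact ⟨h2, h3, h1, by linarith⟩
      · rw [← sub_sub]
        exact dvd_sub_self_right.2 hdvd
    · by_contra! hc
      have h1 : q * w < b * (R * w - B) := by linarith
      obtain ⟨h2, h3⟩ := hη _ h1
      exact h₀ ⟨n, hn, R, by rw [Finset.mem_Icc]; lia, ⟨h2, h3, h1, by linarith⟩, hdvd⟩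
  obtain ⟨L₁, t₁, ht₁, -, ht₁'⟩ := exists_emod_return hb hq hw hB hbB hbad le_rfl
  obtain ⟨L₂, t₂, ht₂, hL₂, ht₂'⟩ :=
    exists_emod_return hb hq hw hB hbB hbad (n := n₀ + L₁) (by lia)
  obtain ⟨L₃, t₃, -, hL₃, ht₃'⟩ :=
    exists_emod_return hb hq hw hB hbB hbad (n := n₀ + L₁ + L₂) (by lia)
  rw [ht₁] at hL₂
  rw [ht₂] at hL₃
  exact ⟨n₀ + L₁ + L₂, L₂, L₃, t₁, t₂, t₃, ht₂, hL₂, hL₃, ht₁', ht₂', ht₃'⟩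

theorem Int.eq_zero_of_pow_dvd {b x : ℤ} {n m : ℕ} (hn : |x| < b ^ n) (hm : |x| < b ^ m) {y z : ℤ}
    (h : y * b ^ n - z * b ^ m = x) : x = 0 := by
  rcases le_total n m with hnm | hmn
  · refine Int.eq_zero_of_abs_lt_dvd (m := b ^ n) ?_ hn
    rw [← h]
    exact dvd_sub (Dvd.intro_left _ rfl) ((pow_dvd_pow b hnm).mul_left z)
  · refine Int.eq_zero_of_abs_lt_dvd (m := b ^ m) ?_ hm
    rw [← h]
    exact dvd_sub ((pow_dvd_pow b hmn).mul_left y) (Dvd.intro_left _ rfl)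

/-- The exceptional configuration of `exists_shift_or_return` does not occur after a large partial
quotient. -/
theorem not_return {b q w w₁ h c t T : ℤ} {n N' m L₁ L₂ : ℕ} {t₁ t₂ t₃ : ℤ} (hb : 2 ≤ b)
    (hq : q = w₁ * b ^ n + h) (hdet : w * c = b ^ N' + q * t)
    (hT : T * (|h| + T) < q) (hn : |h| + T < b ^ n)
    (hw₁ : h < 0 → ∀ M : ℕ, ¬ w₁ ∣ b ^ M)
    (hh : h ≠ 0) (ht₂ : w * b ^ m % q = t₂) (hL₁ : b ^ L₁ * t₁ = q + t₂)
    (hL₂ : b ^ L₂ * t₂ = q + t₃) (h₁ : 0 < t₁ ∧ t₁ ≤ T) (h₂ : 0 < t₂ ∧ t₂ ≤ T)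
    (h₃ : 0 < t₃ ∧ t₃ ≤ T) : False := by
  -- In `b ^ L * t = w₁ * b ^ n + (h + t')` the number `h + t'` is divisible by a power of `b`
  -- exceeding its size, so it vanishes.
  have hbig : ∀ {L : ℕ} {t t' : ℤ}, b ^ L * t = q + t' → 0 < t → t ≤ T → 0 < t' → t' ≤ T →
      t' = -h := by
    intro L t t' hL h1 h2 h3 h4
    have hx : |h + t'| ≤ |h| + T := (abs_add_le _ _).trans (by rw [abs_of_pos h3]; lia)
    have hbL : 0 < b ^ L := by positivity
    have hL' : |h| + T < b ^ L := by
      refine lt_of_mul_lt_mul_left ?_ (h1.trans_le h2).le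
      have h5 : t * b ^ L ≤ T * b ^ L := mul_le_mul_of_nonneg_right h2 hbL.le
      linarith
    have := Int.eq_zero_of_pow_dvd (x := h + t') (hx.trans_lt hL') (hx.trans_lt hn)
      (y := t) (z := w₁) (by rw [mul_comm t, hL, hq]; ring)
    lia
  have e2 := hbig hL₁ h₁.1 h₁.2 h₂.1 h₂.2
  have e3 := hbig hL₂ h₂.1 h₂.2 h₃.1 h₃.2
  have h4 : w₁ * b ^ n = t₂ * b ^ L₂ := by
    have : t₂ * b ^ L₂ = q + t₃ := by rw [← hL₂]; ring
    rw [this, hq, e3]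
    ring
  have hq' : q = t₂ * (b ^ L₂ - 1) := by
    have : q + t₃ = t₂ * b ^ L₂ := by rw [← hL₂]; ring
    rw [e3, ← e2] at this
    linarith
  -- Since `t₂` divides both `q` and `w * b ^ m`, the relation `hdet` makes it divide a power of
  -- `b`; by `h4` so does `w₁`, contradicting `hw₁` for `h = -t₂ < 0`.
  have h5 : t₂ ∣ w * b ^ m := by
    have h6 : q ∣ w * b ^ m - t₂ := by rw [← ht₂]; exact Int.dvd_self_sub_emod
    have h7 : t₂ ∣ q := Dvd.intro _ hq'.symm
    exact (dvd_sub_left dvd_rfl).1 (h7.trans h6)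
  have h8 : t₂ ∣ b ^ (N' + m) := by
    have h9 : w * b ^ m * c = b ^ (N' + m) + q * (t * b ^ m) := by
      rw [mul_right_comm, hdet]
      ring
    have h10 : t₂ ∣ b ^ (N' + m) + q * (t * b ^ m) := h9 ▸ h5.mul_right c
    exact (dvd_add_left ((Dvd.intro _ hq'.symm).mul_right _)).1 h10
  refine hw₁ (by lia) (N' + m + L₂) ?_
  rw [pow_add]
  exact (Dvd.intro _ h4).trans (mul_dvd_mul h8 dvd_rfl)

/-- The sides alternate. From `σ = -1` the orbit never hits `0` modulo `q'`, so
`exists_shift_of_pos` applies; moreover `w'` divides no power of `b`, and this is stored for the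
following step. From `σ = 1` that stored fact, or else `η < r`, lets `not_return` exclude the
exceptional case of `exists_shift_or_return`. -/
theorem Extendable.exists_next {b σ q r w : ℤ} {N : ℕ} (hb : 2 ≤ b) (hσ : σ = 1 ∨ σ = -1)
    (hE : Extendable b σ q r w N) (A : ℕ) :
    ∃ n ≥ A, ∃ a, b ^ n ≤ b * a ∧ a < b ^ n ∧
      ∀ w', w' * q = σ * b ^ (N + n) + (a * q + r) * (w * b ^ n - a * q) →
        Extendable b (-σ) (a * q + r) q w' (N + n) := by
  obtain ⟨hq, hw, hqw, hwq, η, hη₀, hηr, hu, hu', hη, hsw, hfreq⟩ := hE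
  have hB : 0 < b ^ N := by positivity
  have hh : r - η ≠ 0 := sub_ne_zero.2 hηr.symm
  have hηh : η * (r - η) ≠ 0 := mul_ne_zero hη₀ hh
  -- A return value satisfies `t w' ≤ b b^(N+n)` with `w' > b^n / (2 b)`, so `T` bounds it
  -- independently of `n`, and `n` can be taken large compared with `T`.
  set T : ℤ := 2 * b ^ 2 * b ^ N with hT
  have hTpos : 0 < T := by positivity
  obtain ⟨n, hdvd, hnA, hn₁, hn₂, hP₁, hP₂, hP₃, hP₄, hP₅, hP₆, hP₇, hP₈⟩ :=
    (hfreq.and_eventually ((eventually_ge_atTop A).and <|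
      (eventually_ge_atTop (r - η).natAbs).and <|
      (eventually_ge_atTop (η * (r - η)).natAbs).and <| (eventually_lt_pow hb (b * |η|)).and <|
      (eventually_lt_pow hb (b * |η * (r - η)| + |q * (r - η)|)).and <|
      (eventually_lt_pow hb (2 * |r - η| + 2 * b * q)).and <|
      (eventually_lt_pow hb (4 * b ^ 3 * b ^ N)).and <|
      (eventually_lt_pow hb (2 * b * |η * (r - η)|)).and <|
      (eventually_lt_pow hb (2 * |r - η|)).and <|
      (eventually_lt_pow hb (|r - η| + T)).and <|
      eventually_lt_pow hb (2 * (T * (|r - η| + T))))).exists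
  obtain ⟨a, ha⟩ := hdvd
  have ha' : a * q = w * b ^ n - η := by rw [ha, mul_comm]
  obtain ⟨ha₁, ha₂⟩ := partial_quotient_bounds hb hq hqw hwq hη hP₁ ha'
  refine ⟨n, hnA, a, ha₁, ha₂, fun w' hw' => ?_⟩
  obtain ⟨q', hq'⟩ : ∃ q', q' = a * q + r := ⟨_, rfl⟩
  have hq'eq : q' = w * b ^ n + (r - η) := by rw [hq', ha']; ring
  have hdet : w' * q = σ * b ^ (N + n) + q' * η := by rw [hw', ← hq', ha']; ring
  have hw'eq : w' * q = (η * w + σ * b ^ N) * b ^ n + η * (r - η) := by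
    rw [hdet, hq'eq, pow_add]
    ring
  obtain ⟨h1, h2, h3, h4, h5⟩ := next_bounds hb hσ hq hw hB hu hu' hP₂ hP₃ hP₄ hq'eq hw'eq
  rw [← hq']
  have hPpos : 0 < b ^ n := by positivity
  have hq'pos : 0 < q' := by lia
  have hw'pos : 0 < w' := pos_of_mul_pos_right (by linarith : 0 < b * w') (by lia)
  have hB' : b ^ (N + n) = b ^ N * b ^ n := pow_add _ _ _
  have hB'pos : 0 < b ^ (N + n) := by positivity
  rw [← hB'] at h4
  refine ⟨hq'pos, hw'pos, h1, h2.le, ?_⟩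
  rcases hσ with rfl | rfl
  · rcases exists_shift_or_return hb hq'pos hw'pos hB'pos h3 hq h4 with
      ⟨η', ⟨e1, e2, e3, e4⟩, hf⟩ | ⟨m, L₁, L₂, t₁, t₂, t₃, e1, e2, e3, f1, f2, f3⟩
    · refine ⟨η', e1.ne', e2.ne', ?_, Or.inl ?_, Or.inl h2, fun h => absurd h (by lia), hf⟩ <;>
        linarith
    · exfalso
      have hTb : ∀ t, t * w' ≤ b * b ^ (N + n) → t ≤ T := by
        intro t ht
        by_contra! hc
        have g1 : T * w' ≤ t * w' := mul_le_mul_of_nonneg_right hc.le hw'pos.le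
        have g2 : T * (2 * q') < T * (2 * (b * w')) := by gcongr
        have g3 : T * b ^ n < T * (2 * q') := by gcongr
        have g4 : 2 * b * (T * w') ≤ 2 * b * (b * b ^ (N + n)) :=
          mul_le_mul_of_nonneg_left (g1.trans ht) (by lia)
        have g5 : T * b ^ n = 2 * b * (b * b ^ (N + n)) := by rw [hT, hB']; ring
        linarith
      refine not_return (c := q) (t := η) (N' := N + n) hb hq'eq (by rw [hdet, one_mul])
        (by linarith) hP₇ (fun hneg M => ?_) hh e1 e2 e3 ⟨f1.1, hTb _ f1.2⟩ ⟨f2.1, hTb _ f2.2⟩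
        ⟨f3.1, hTb _ f3.2⟩
      rcases hsw rfl with h | h
      · lia
      · exact h M
  -- By `hdet` such a divisibility would make `q'` divide a power of `b`, hence also the nonzero
  -- number `r - η`, which is smaller than `q'`. The proof of `hw'nd` is analogous, with `η * (r -
  -- η)`.
  · have hnd : ∀ m, ¬ q' ∣ w' * b ^ m := by
      intro m hm
      have g1 : w' * b ^ m * q = -b ^ (N + n + m) + q' * (η * b ^ m) := by
        rw [mul_right_comm, hdet]
        ring
      have g2 : q' ∣ -b ^ (N + n + m) + q' * (η * b ^ m) := g1 ▸ hm.mul_right q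
      have g3 : q' ∣ b ^ (N + n + m) := (dvd_neg).1 ((dvd_add_left (Dvd.intro _ rfl)).1 g2)
      have g4 : q' ∣ r - η :=
        Int.dvd_of_dvd_pow_of_dvd_mul_pow_add hh hn₁ g3 (by rw [← hq'eq])
      have g5 := Int.le_of_dvd (abs_pos.2 hh) ((dvd_abs _ _).2 g4)
      linarith
    have hw'nd : ∀ M : ℕ, ¬ w' ∣ b ^ M := by
      intro M hM
      have g4 : w' ∣ η * (r - η) :=
        Int.dvd_of_dvd_pow_of_dvd_mul_pow_add hηh hn₂ hM (by rw [← hw'eq]; exact Dvd.intro _ rfl)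
      have g5 := Int.le_of_dvd (abs_pos.2 hηh) ((dvd_abs _ _).2 g4)
      have g6 : 2 * b * w' ≤ 2 * b * |η * (r - η)| := mul_le_mul_of_nonneg_left g5 (by lia)
      linarith
    obtain ⟨η', ⟨e1, e2, e3, e4⟩, hf⟩ :=
      exists_shift_of_pos hb hq'pos hw'pos hB'pos h3 hq hnd h4
    refine ⟨η', e1.ne', e2.ne', ?_, Or.inl ?_, Or.inl h2, fun _ => Or.inr hw'nd, hf⟩ <;> linarith

/-! ### Convergents of finite prefixes -/

section Convergents

/-- The last two convergents `p / q` and `p' / q'` of a finite list of partial quotients, and the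
number `K` and the length `N` of the concatenation of their digit strings. -/
structure PrefixData where
  p : ℤ
  q : ℤ
  p' : ℤ
  q' : ℤ
  K : ℤ
  N : ℕ

def PrefixData.snoc (b : ℕ) (s : PrefixData) (a : ℕ) : PrefixData where
  p := a * s.p + s.p'
  q := a * s.q + s.q'
  p' := s.p
  q' := s.q
  K := b ^ (Nat.digits b a).length * s.K + a
  N := s.N + (Nat.digits b a).length

/-- The seed is the convergent `0 / 1` preceded by the formal `1 / 0`, with no digits written. -/
def prefixData (b : ℕ) (l : List ℕ) : PrefixData :=
  l.foldl (PrefixData.snoc b) ⟨0, 1, 1, 0, 0, 0⟩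

theorem prefixData_concat (b : ℕ) (l : List ℕ) (a : ℕ) :
    prefixData b (l ++ [a]) = (prefixData b l).snoc b a := by
  simp [prefixData, List.foldl_append]

theorem map_range_succ (a : ℕ → ℕ) (n : ℕ) :
    (List.range (n + 1)).map a = (List.range n).map a ++ [a n] := by
  simp [List.range_succ]

theorem infContFract_s_get? (a : ℕ → ℕ) (n : ℕ) :
    (infContFract a).s.get? n = some ⟨1, (a n : ℝ)⟩ := rfl

theorem infContFract_contsAux (b : ℕ) (a : ℕ → ℕ) (n : ℕ) :
    (infContFract a).contsAux n = ⟨((prefixData b ((List.range n).map a)).p' : ℝ),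
      ((prefixData b ((List.range n).map a)).q' : ℝ)⟩ ∧
    (infContFract a).contsAux (n + 1) = ⟨((prefixData b ((List.range n).map a)).p : ℝ),
      ((prefixData b ((List.range n).map a)).q : ℝ)⟩ := by
  induction n with
  | zero => simp [prefixData, infContFract, GenContFract.contsAux]
  | succ n ih =>
    rw [map_range_succ, prefixData_concat]
    refine ⟨ih.2, ?_⟩
    rw [GenContFract.contsAux_recurrence (infContFract_s_get? a n) ih.1 ih.2]
    simp [PrefixData.snoc]

theorem infContFract_convs (b : ℕ) (a : ℕ → ℕ) (n : ℕ) :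
    (infContFract a).convs n = (prefixData b ((List.range n).map a)).p /
      (prefixData b ((List.range n).map a)).q := by
  rw [GenContFract.conv_eq_conts_a_div_conts_b, GenContFract.nth_cont_eq_succ_nth_contAux,
    (infContFract_contsAux b a n).2]

end Convergents

/-! ### Digit strings and `b`-adic intervals -/

section Digits

variable {b : ℕ}

theorem prefixData_K (b : ℕ) (l : List ℕ) :
    (prefixData b l).K = (Nat.ofDigits b (l.flatMap (digitString b)).reverse : ℕ) ∧
      (prefixData b l).N = (l.flatMap (digitString b)).length := by
  induction l using List.reverseRecOn with
  | nil => simp [prefixData]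
  | append_singleton l a ih =>
    rw [prefixData_concat]
    constructor
    · simp only [PrefixData.snoc, ih.1, List.flatMap_append, List.flatMap_singleton,
        List.reverse_append, digitString, List.reverse_reverse, Nat.ofDigits_append,
        Nat.ofDigits_digits]
      push_cast
      ring
    · simp [PrefixData.snoc, ih.2, digitString]

theorem concatPrefix_eq_flatMap (b : ℕ) (a : ℕ → ℕ) (n : ℕ) :
    concatPrefix b a n = ((List.range n).map a).flatMap (digitString b) := by
  rw [concatPrefix, List.flatMap_map]

theorem concatPrefix_succ (b : ℕ) (a : ℕ → ℕ) (n : ℕ) :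
    concatPrefix b a (n + 1) = concatPrefix b a n ++ digitString b (a n) := by
  simp [concatPrefix, List.range_succ]

theorem concatPrefix_prefix (b : ℕ) (a : ℕ → ℕ) {m n : ℕ} (h : m ≤ n) :
    concatPrefix b a m <+: concatPrefix b a n := by
  induction n, h using Nat.le_induction with
  | base => exact List.prefix_rfl
  | succ n _ ih => exact ih.trans (concatPrefix_succ b a n ▸ List.prefix_append _ _)

theorem le_length_concatPrefix {a : ℕ → ℕ} (ha : ∀ n, 0 < a n) (n : ℕ) :
    n ≤ (concatPrefix b a n).length := by
  induction n with
  | zero => simp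
  | succ n ih =>
    have : 0 < (Nat.digits b (a n)).length :=
      List.length_pos_iff.2 (Nat.digits_ne_nil_iff_ne_zero.2 (ha n).ne')
    rw [concatPrefix_succ, List.length_append, digitString, List.length_reverse]
    lia

theorem concatPrefix_eq_map {a : ℕ → ℕ} (ha : ∀ n, 0 < a n) (n : ℕ) :
    concatPrefix b a n = (List.range (concatPrefix b a n).length).map (concatDigit b a) := by
  refine List.ext_getElem (by simp) fun i h1 h2 => ?_
  simp only [List.getElem_map, List.getElem_range, concatDigit]
  have h3 := le_length_concatPrefix (b := b) ha (i + 1)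
  have h4 : i < (concatPrefix b a (i + 1)).length := by lia
  rw [List.getD_eq_getElem _ _ h4]
  rcases le_total n (i + 1) with h | h
  · exact (concatPrefix_prefix b a h).getElem h1
  · exact ((concatPrefix_prefix b a h).getElem h4).symm

theorem concatDigit_lt (hb : 2 ≤ b) (a : ℕ → ℕ) (k : ℕ) : concatDigit b a k < b := by
  rw [concatDigit]
  rcases lt_or_ge k (concatPrefix b a (k + 1)).length with h | h
  · rw [List.getD_eq_getElem _ _ h]
    have h1 := List.getElem_mem h
    simp only [concatPrefix, digitString, List.mem_flatMap, List.mem_reverse] at h1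
    obtain ⟨i, -, hi⟩ := h1
    exact Nat.digits_lt_base (by lia) hi
  · rw [List.getD_eq_default _ _ h]
    lia

theorem ofDigits_map_range_reverse (hb : 2 ≤ b) (d : ℕ → Fin b) (N : ℕ) :
    ((Nat.ofDigits b ((List.range N).map fun i => (d i : ℕ)).reverse : ℕ) : ℝ) =
      b ^ N * ∑ i ∈ Finset.range N, Real.ofDigitsTerm d i := by
  induction N with
  | zero => simp
  | succ N ih =>
    have hb' : (b : ℝ) ≠ 0 := by positivity
    rw [List.range_succ, List.map_append, List.reverse_append, Finset.sum_range_succ]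
    simp only [List.map_cons, List.map_nil, List.reverse_singleton, List.singleton_append,
      Nat.ofDigits_cons, Nat.cast_add, Nat.cast_mul]
    rw [ih, Real.ofDigitsTerm]
    field_simp
    ring

/-- The closed interval of numbers whose `b`-adic expansion starts with the digit strings of the
entries of `l`. -/
def digitInterval (b : ℕ) (l : List ℕ) : Set ℝ :=
  Set.Icc ((prefixData b l).K / (b : ℝ) ^ (prefixData b l).N)
    (((prefixData b l).K + 1) / (b : ℝ) ^ (prefixData b l).N)

theorem ofDigits_mem_digitInterval (hb : 2 ≤ b) {a : ℕ → ℕ} (ha : ∀ n, 0 < a n) {d : ℕ → Fin b}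
    (hd : ∀ k, (d k : ℕ) = concatDigit b a k) (n : ℕ) :
    Real.ofDigits d ∈ digitInterval b ((List.range n).map a) := by
  have hb' : (0 : ℝ) < b := by positivity
  obtain ⟨h1, h2⟩ := prefixData_K b ((List.range n).map a)
  rw [← concatPrefix_eq_flatMap] at h1 h2
  rw [digitInterval, Set.mem_Icc, h1, h2, Real.ofDigits_eq_sum_add_ofDigits d
    (concatPrefix b a n).length]
  have h3 := ofDigits_map_range_reverse hb d (concatPrefix b a n).length
  simp only [hd] at h3
  rw [← concatPrefix_eq_map ha] at h3
  have h4 := Real.ofDigits_nonneg fun i => d (i + (concatPrefix b a n).length)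
  have h5 := Real.ofDigits_le_one fun i => d (i + (concatPrefix b a n).length)
  rw [Int.cast_natCast, h3]
  have h6 : (0 : ℝ) < b ^ (concatPrefix b a n).length := by positivity
  rw [add_div, mul_div_cancel_left₀ _ h6.ne', one_div]
  constructor
  · have := mul_nonneg (inv_nonneg.2 h6.le) h4
    linarith
  · have := mul_le_mul_of_nonneg_left h5 (inv_nonneg.2 h6.le)
    linarith

theorem abs_sub_le_of_mem_digitInterval {l : List ℕ} {x y : ℝ} (hx : x ∈ digitInterval b l)
    (hy : y ∈ digitInterval b l) : |x - y| ≤ 1 / (b : ℝ) ^ (prefixData b l).N := by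
  rw [digitInterval, Set.mem_Icc, add_div] at hx hy
  rw [abs_le]
  constructor <;> linarith [hx.1, hx.2, hy.1, hy.2]

theorem le_prefixData_N {l : List ℕ} (hl : ∀ x ∈ l, 0 < x) : l.length ≤ (prefixData b l).N := by
  induction l using List.reverseRecOn with
  | nil => simp
  | append_singleton l a ih =>
    have h1 := ih fun x hx => hl x (by simp [hx])
    have h2 : 0 < (Nat.digits b a).length :=
      List.length_pos_iff.2 (Nat.digits_ne_nil_iff_ne_zero.2 (hl a (by simp)).ne')
    rw [prefixData_concat, PrefixData.snoc, List.length_append, List.length_singleton]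
    lia

end Digits

/-! ### Good prefixes: extension and existence -/

section GoodPrefix

variable {b : ℕ}

/-- A finite list of positive integers that can be continued to Trott numbers. -/
structure GoodPrefix (b : ℕ) (l : List ℕ) : Prop where
  pos : ∀ x ∈ l, 0 < x
  q'_nonneg : 0 ≤ (prefixData b l).q'
  exists_extendable : ∃ σ : ℤ, (σ = 1 ∨ σ = -1) ∧
    (prefixData b l).p' * (prefixData b l).q - (prefixData b l).p * (prefixData b l).q' = σ ∧
    Extendable b σ (prefixData b l).q (prefixData b l).q'
      (b ^ (prefixData b l).N * (prefixData b l).p - (prefixData b l).q * (prefixData b l).K)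
      (prefixData b l).N

/-- The value of the finite continued fraction with partial quotients `l`. -/
noncomputable def prefixValue (b : ℕ) (l : List ℕ) : ℝ :=
  ((prefixData b l).p : ℝ) / (prefixData b l).q

theorem GoodPrefix.prefixValue_mem (hb : 2 ≤ b) {l : List ℕ} (hl : GoodPrefix b l) :
    prefixValue b l ∈ digitInterval b l := by
  obtain ⟨σ, -, -, h⟩ := hl.exists_extendable
  have hq : (0 : ℝ) < (prefixData b l).q := by exact_mod_cast h.q_pos
  have hb' : (0 : ℝ) < (b : ℝ) ^ (prefixData b l).N := by positivity
  have h1 : (0 : ℝ) < b ^ (prefixData b l).N * (prefixData b l).p -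
      (prefixData b l).q * (prefixData b l).K := by exact_mod_cast h.w_pos
  have h2 : (b : ℝ) ^ (prefixData b l).N * (prefixData b l).p -
      (prefixData b l).q * (prefixData b l).K ≤ (prefixData b l).q := by exact_mod_cast h.le
  rw [prefixValue, digitInterval, Set.mem_Icc, div_le_div_iff₀ hb' hq, div_le_div_iff₀ hq hb']
  constructor <;> linarith

theorem length_digits_eq (hb : 2 ≤ b) {a n : ℕ} (h₁ : b ^ n ≤ b * a) (h₂ : a < b ^ n) :
    (Nat.digits b a).length = n := by
  refine le_antisymm ((Nat.digits_length_le_iff (by lia) _).2 h₂) ?_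
  rcases n with _ | n
  · exact Nat.zero_le _
  · refine (Nat.lt_digits_length_iff (by lia) _).2 ?_
    rw [pow_succ'] at h₁
    exact Nat.le_of_mul_le_mul_left h₁ (by lia)

theorem digitInterval_concat_subset (hb : 2 ≤ b) (l : List ℕ) (a : ℕ) :
    digitInterval b (l ++ [a]) ⊆ digitInterval b l := by
  have hb' : (0 : ℝ) < b := by positivity
  have ha : (a : ℝ) + 1 ≤ (b : ℝ) ^ (Nat.digits b a).length := by
    exact_mod_cast Nat.lt_base_pow_length_digits (b := b) (m := a) (by lia)
  rw [digitInterval, digitInterval, prefixData_concat]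
  simp only [PrefixData.snoc]
  refine Set.Icc_subset_Icc ?_ ?_
  · rw [div_le_div_iff₀ (by positivity) (by positivity), pow_add]
    push_cast
    have : (0 : ℝ) ≤ a * (b : ℝ) ^ (prefixData b l).N := by positivity
    linarith
  · rw [div_le_div_iff₀ (by positivity) (by positivity), pow_add]
    push_cast
    have := mul_le_mul_of_nonneg_right ha (by positivity : 0 ≤ (b : ℝ) ^ (prefixData b l).N)
    linarith

theorem GoodPrefix.exists_concat (hb : 2 ≤ b) {l : List ℕ} (hl : GoodPrefix b l) (m : ℕ) :
    ∃ a, GoodPrefix b (l ++ [a]) ∧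
      ∀ x ∈ digitInterval b (l ++ [a]), |x - prefixValue b l| ≤ 1 / ((m : ℝ) + 1) := by
  obtain ⟨σ, hσ, hdet, hE⟩ := hl.exists_extendable
  have hbz : (2 : ℤ) ≤ b := by exact_mod_cast hb
  -- The new interval has length at most `b^(-n)` and the convergent moves by at most `b b^(-n)`;
  -- since `b^n > n`, this `n` makes the sum at most `1 / (m + 1)`.
  obtain ⟨n, hn, a', h1, h2, h3⟩ := hE.exists_next hbz hσ ((b + 1) * (m + 1))
  have hbn : (0 : ℤ) < b ^ n := by positivity
  have ha' : 0 < a' := pos_of_mul_pos_right (hbn.trans_le h1) (by lia)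
  obtain ⟨a, rfl⟩ := Int.eq_ofNat_of_zero_le ha'.le
  have h1' : b ^ n ≤ b * a := by exact_mod_cast h1
  have hlen : (Nat.digits b a).length = n := length_digits_eq hb h1' (by exact_mod_cast h2)
  have hq := hE.q_pos
  have hq' := hl.q'_nonneg
  have hgood : GoodPrefix b (l ++ [a]) := by
    refine ⟨?_, ?_, -σ, by lia, ?_, ?_⟩
    · intro x hx
      rw [List.mem_append, List.mem_singleton] at hx
      rcases hx with hx | rfl
      · exact hl.pos x hx
      · exact_mod_cast ha'
    · rw [prefixData_concat]
      exact hq.le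
    · rw [prefixData_concat]
      simp only [PrefixData.snoc]
      rw [← hdet]
      ring
    · rw [prefixData_concat]
      simp only [PrefixData.snoc, hlen]
      refine h3 _ ?_
      rw [← hdet, pow_add]
      ring
  refine ⟨a, hgood, fun x hx => ?_⟩
  have e1 := abs_sub_le_of_mem_digitInterval hx (hgood.prefixValue_mem hb)
  have hbr : (0 : ℝ) < b := by positivity
  have har : (0 : ℝ) < a := by exact_mod_cast ha'
  have hbnr : (0 : ℝ) < (b : ℝ) ^ n := by positivity
  have hqr : (1 : ℝ) ≤ (prefixData b l).q := by exact_mod_cast hq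
  have hqr' : (0 : ℝ) ≤ (prefixData b l).q' := by exact_mod_cast hq'
  have e2 : |prefixValue b (l ++ [a]) - prefixValue b l| ≤ b / (b : ℝ) ^ n := by
    have f1 : (a : ℝ) ≤ a * (prefixData b l).q + (prefixData b l).q' := by nlinarith
    have f2 : prefixValue b (l ++ [a]) - prefixValue b l =
        σ / ((a * (prefixData b l).q + (prefixData b l).q') * (prefixData b l).q) := by
      rw [prefixValue, prefixValue, prefixData_concat]
      simp only [PrefixData.snoc]
      push_cast
      rw [div_sub_div _ _ (by linarith) (by linarith)]
      congr 1
      rw [← hdet]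
      push_cast
      ring
    have f3 : |(σ : ℝ)| = 1 := by rcases hσ with rfl | rfl <;> simp
    have f4 : (a : ℝ) ≤ (a * (prefixData b l).q + (prefixData b l).q') * (prefixData b l).q := by
      nlinarith
    rw [f2, abs_div, f3, abs_of_pos (har.trans_le f4), div_le_div_iff₀ (har.trans_le f4) hbnr]
    have f5 : (b : ℝ) ^ n ≤ b * a := by exact_mod_cast h1'
    have f6 := mul_le_mul_of_nonneg_left f4 hbr.le
    linarith
  have e3 : 1 / (b : ℝ) ^ (prefixData b (l ++ [a])).N ≤ 1 / (b : ℝ) ^ n := by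
    refine one_div_le_one_div_of_le hbnr ?_
    rw [prefixData_concat]
    simp only [PrefixData.snoc, hlen]
    exact pow_le_pow_right₀ (by exact_mod_cast (by lia : 1 ≤ b)) (by lia)
  have e4 : ((b : ℝ) + 1) / (b : ℝ) ^ n ≤ 1 / ((m : ℝ) + 1) := by
    rw [div_le_div_iff₀ hbnr (by positivity), one_mul]
    have : (b + 1) * (m + 1) ≤ b ^ n := hn.trans (Nat.lt_pow_self (by lia)).le
    exact_mod_cast this
  calc |x - prefixValue b l|
      ≤ |x - prefixValue b (l ++ [a])| + |prefixValue b (l ++ [a]) - prefixValue b l| :=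
        abs_sub_le _ _ _
    _ ≤ 1 / (b : ℝ) ^ n + b / (b : ℝ) ^ n := add_le_add (e1.trans e3) e2
    _ = ((b : ℝ) + 1) / (b : ℝ) ^ n := by ring
    _ ≤ _ := e4

/-- For `b = k² + x` with `1 ≤ x ≤ k`, the convergent `1 / k` has position `x / k` in `[k / b, (k +
1) / b]`. For `b = 3`, the convergent `1 / 2 = (0.111…)₃` sits in the middle of the interval of the
digits `11`. -/
theorem exists_goodPrefix {b : ℕ} (hb : b ∈ Gam) : 2 ≤ b ∧ ∃ l, GoodPrefix b l := by
  rcases hb with hb | hb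
  · rw [Set.mem_singleton_iff] at hb
    subst hb
    refine ⟨by norm_num, [1, 1], by simp, by simp [prefixData, PrefixData.snoc], 1, Or.inl rfl,
      ?_, ?_⟩
    · simp [prefixData, PrefixData.snoc]
    · simp only [prefixData, PrefixData.snoc, List.foldl_cons, List.foldl_nil]
      norm_num
      -- Here `q = 2`, `w = 1`, `N = 2`, and `-7 + 3² = 2 = q w` is the boundary case; any odd shift
      -- is congruent to `3 ^ n` modulo `2`.
      refine ⟨by norm_num, by norm_num, by norm_num, by norm_num, -7, by norm_num, by norm_num,
        by norm_num, Or.inr (by norm_num), Or.inl (by norm_num), fun _ => Or.inl (by norm_num),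
        Frequently.of_forall fun n => ?_⟩
      have : Odd ((3 : ℤ) ^ n) := Odd.pow (by decide)
      obtain ⟨k, hk⟩ := this
      exact ⟨k + 4, by rw [hk]; ring⟩
  · simp only [Set.mem_iUnion, Set.mem_Ici, Set.mem_Icc] at hb
    obtain ⟨k, hk, h1, h2⟩ := hb
    obtain ⟨j, rfl⟩ := Nat.exists_eq_add_of_le h1
    have hkb : k < k ^ 2 + 1 + j := by nlinarith
    have hb2 : 2 ≤ k ^ 2 + 1 + j := by nlinarith
    refine ⟨hb2, [k], by simpa using (by lia : 0 < k), by simp [prefixData, PrefixData.snoc],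
      -1, Or.inr rfl, by simp [prefixData, PrefixData.snoc], ?_⟩
    have hlen : (Nat.digits (k ^ 2 + 1 + j) k).length = 1 := by
      rw [Nat.digits_of_lt _ _ (by lia) hkb, List.length_singleton]
    simp only [prefixData, PrefixData.snoc, List.foldl_cons, List.foldl_nil, hlen]
    have hj : j + 1 ≤ k := by lia
    obtain ⟨x, hx⟩ : ∃ x : ℤ, x = j + 1 := ⟨_, rfl⟩
    obtain ⟨y, hy⟩ : ∃ y : ℤ, y = k := ⟨_, rfl⟩
    have hx1 : 1 ≤ x := by lia
    have hxy : x ≤ y := by lia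
    have hB : ((k ^ 2 + 1 + j : ℕ) : ℤ) = y ^ 2 + x := by push_cast; rw [hx, hy]; ring
    rw [hB, ← hy]
    simp only [zero_add, mul_zero, mul_one, add_zero, pow_one]
    rw [show y ^ 2 + x - y * y = x by ring]
    obtain ⟨η, ⟨hη1, hη2⟩, hη⟩ := frequently_dvd_sub_of_frequently (b := y ^ 2 + x) (q := y)
      (w := x) (p := fun η => y ^ 2 + x < η * x ∧ (η - y) * x ≤ y ^ 2 + x)
      (s := Finset.Icc 0 (y ^ 2 + x + y)) (by
        intro n
        set B := y ^ 2 + x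
        set c := B / x
        -- `c + 1 + R` is the least integer above `B / x` that is congruent to `x * B ^ n` modulo
        -- `y`.
        set R := (x * B ^ n - c - 1) % y
        have hBpos : 0 < B := by positivity
        have f1 : B < (c + 1) * x := Int.lt_ediv_add_one_mul_self _ (by lia)
        have f2 : c * x ≤ B := Int.ediv_mul_le _ (by lia)
        have f3 : c ≤ B := Int.ediv_le_self _ hBpos.le
        have f4 : 0 ≤ c := Int.ediv_nonneg hBpos.le (by lia)
        have f5 : 0 ≤ R := Int.emod_nonneg _ (by lia)
        have f6 : R < y := Int.emod_lt_of_pos _ (by lia)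
        refine ⟨n, le_rfl, c + 1 + R, by rw [Finset.mem_Icc]; lia, ⟨?_, ?_⟩, ?_⟩
        · have := mul_nonneg f5 (by lia : 0 ≤ x)
          linarith
        · have := mul_le_mul_of_nonneg_right (by lia : c + 1 + R - y ≤ c) (by lia : 0 ≤ x)
          linarith
        · have : y ∣ (x * B ^ n - c - 1) - R := Int.dvd_self_sub_emod
          convert this using 1
          ring)
    have hη' : y < η := by
      refine lt_of_mul_lt_mul_right ?_ (by lia : 0 ≤ x)
      nlinarith
    refine ⟨by lia, by lia, by nlinarith, hxy, η, by lia, by lia, ?_, ?_, Or.inr (by lia),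
      fun h => absurd h (by norm_num), hη⟩
    · nlinarith
    · rcases eq_or_lt_of_le hη2 with h | h
      · right
        constructor <;> linarith
      · left
        linarith

end GoodPrefix

/-! ### Uniqueness of infinite continued fractions and irrationality -/

section ContinuedFractions

/-- The partial quotients of the regular continued fraction of a number in `(0, 1)`. -/
noncomputable def partQuot (x : ℝ) (n : ℕ) : ℕ := ⌊((fun y : ℝ => Int.fract y⁻¹)^[n] x)⁻¹⌋₊

theorem partQuot_succ (x : ℝ) (n : ℕ) : partQuot x (n + 1) = partQuot (Int.fract x⁻¹) n := by
  rw [partQuot, Function.iterate_succ_apply, partQuot]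

theorem irrational_fract_inv {x : ℝ} (hx : Irrational x) : Irrational (Int.fract x⁻¹) := by
  rw [Int.fract]
  exact (irrational_inv_iff.2 hx).sub_intCast _

theorem fract_inv_mem_Ioo {x : ℝ} (hx : Irrational x) : Int.fract x⁻¹ ∈ Set.Ioo (0 : ℝ) 1 :=
  ⟨lt_of_le_of_ne (Int.fract_nonneg _) (irrational_fract_inv hx).ne_zero.symm, Int.fract_lt_one _⟩

theorem GenContFract.of_s_get?_eq_partQuot {x : ℝ} (hx : Irrational x) (n : ℕ) :
    (GenContFract.of x).s.get? n = some ⟨1, (partQuot (Int.fract x) n : ℝ)⟩ := by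
  have hfr : ∀ {y : ℝ}, Irrational y → Irrational (Int.fract y) := fun hy => hy.sub_intCast _
  induction n generalizing x with
  | zero =>
    have := GenContFract.of_s_head (v := x) (hfr hx).ne_zero
    rw [Stream'.Seq.head] at this
    rw [this, partQuot, Function.iterate_zero, id, natCast_floor_eq_intCast_floor]
    exact inv_nonneg.2 (Int.fract_nonneg x)
  | succ n ih =>
    rw [GenContFract.of_s_succ, ih (irrational_inv_iff.2 (hfr hx)), partQuot_succ]

theorem isInfContFractOf_partQuot {x : ℝ} (hx : Irrational x) (hx' : x ∈ Set.Ioo (0 : ℝ) 1) :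
    IsInfContFractOf (partQuot x) x := by
  have hfr : Int.fract x = x := Int.fract_eq_self.2 ⟨hx'.1.le, hx'.2⟩
  have heq : infContFract (partQuot x) = GenContFract.of x := by
    refine GenContFract.ext ?_ (Stream'.Seq.ext fun n => ?_)
    · rw [GenContFract.of_h_eq_floor, Int.floor_eq_zero_iff.2 ⟨hx'.1.le, hx'.2⟩, Int.cast_zero]
      rfl
    · rw [GenContFract.of_s_get?_eq_partQuot hx, hfr]
      rfl
  refine ⟨fun n => ?_, heq ▸ GenContFract.of_convergence x⟩
  induction n generalizing x with
  | zero =>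
    rw [partQuot, Function.iterate_zero, id, Nat.floor_pos]
    exact (one_lt_inv₀ hx'.1).2 hx'.2 |>.le
  | succ n ih =>
    have h := fract_inv_mem_Ioo hx
    have hfr' : Int.fract (Int.fract x⁻¹) = Int.fract x⁻¹ := Int.fract_fract _
    rw [partQuot_succ]
    refine ih (irrational_fract_inv hx) h hfr' ?_
    refine GenContFract.ext ?_ (Stream'.Seq.ext fun n => ?_)
    · rw [GenContFract.of_h_eq_floor, Int.floor_eq_zero_iff.2 ⟨h.1.le, h.2⟩, Int.cast_zero]
      rfl
    · rw [GenContFract.of_s_get?_eq_partQuot (irrational_fract_inv hx), hfr']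
      rfl

theorem infContFract_convs_succ {a : ℕ → ℕ} (ha : ∀ n, 0 < a n) (n : ℕ) :
    (infContFract a).convs (n + 1) = ((a 0 : ℝ) + (infContFract fun i => a (i + 1)).convs n)⁻¹ := by
  have hpos : ∀ {c : ℕ → ℕ}, (∀ n, 0 < c n) → ∀ m, (infContFract c).convs m =
      (infContFract c).convs' m := by
    intro c hc m
    refine GenContFract.convs_eq_convs' fun {gp k} _ h => ?_
    rw [infContFract_s_get?, Option.some_inj] at h
    subst h
    exact ⟨one_pos, Nat.cast_pos.2 (hc k)⟩
  rw [hpos ha, hpos fun i => ha (i + 1), GenContFract.convs', GenContFract.convs',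
    GenContFract.convs'Aux_succ_some (p := ⟨1, (a 0 : ℝ)⟩) rfl]
  simp only [infContFract, zero_add, one_div]
  rfl

theorem infContFract_convs_nonneg {a : ℕ → ℕ} (ha : ∀ n, 0 < a n) (n : ℕ) :
    0 ≤ (infContFract a).convs n := by
  induction n generalizing a with
  | zero => simp [infContFract]
  | succ n ih =>
    rw [infContFract_convs_succ ha]
    exact inv_nonneg.2 (add_nonneg (Nat.cast_nonneg _) (ih fun i => ha (i + 1)))

theorem infContFract_convs_succ_le_one {a : ℕ → ℕ} (ha : ∀ n, 0 < a n) (n : ℕ) :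
    (infContFract a).convs (n + 1) ≤ 1 := by
  rw [infContFract_convs_succ ha]
  have h1 := infContFract_convs_nonneg (fun i => ha (i + 1)) n
  have h2 : (1 : ℝ) ≤ a 0 := Nat.one_le_cast.2 (ha 0)
  exact inv_le_one_of_one_le₀ (by linarith)

theorem IsInfContFractOf.pos {a : ℕ → ℕ} {x : ℝ} (h : IsInfContFractOf a x) : 0 < x := by
  have h0 : (0 : ℝ) < ((a 0 : ℝ) + 1)⁻¹ := by positivity
  refine h0.trans_le (ge_of_tendsto' ((tendsto_add_atTop_iff_nat 2).2 h.2) fun n => ?_)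
  rw [infContFract_convs_succ h.1]
  have h1 := infContFract_convs_nonneg (fun i => h.1 (i + 1)) (n + 1)
  have h2 := infContFract_convs_succ_le_one (fun i => h.1 (i + 1)) n
  have h3 : (1 : ℝ) ≤ a 0 := Nat.one_le_cast.2 (h.1 0)
  exact inv_anti₀ (by linarith) (by linarith)

theorem IsInfContFractOf.tail {a : ℕ → ℕ} {x : ℝ} (h : IsInfContFractOf a x) :
    IsInfContFractOf (fun i => a (i + 1)) (x⁻¹ - a 0) := by
  refine ⟨fun n => h.1 _, ?_⟩
  have h1 := (((tendsto_add_atTop_iff_nat 1).2 h.2).inv₀ h.pos.ne').sub_const (a 0 : ℝ)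
  refine h1.congr fun n => ?_
  rw [infContFract_convs_succ h.1, inv_inv, add_sub_cancel_left]

theorem IsInfContFractOf.lt_one {a : ℕ → ℕ} {x : ℝ} (h : IsInfContFractOf a x) : x < 1 := by
  have h1 := h.tail.pos
  have h2 : (1 : ℝ) ≤ a 0 := Nat.one_le_cast.2 (h.1 0)
  exact (one_lt_inv₀ h.pos).1 (by linarith)

theorem IsInfContFractOf.floor_inv {a : ℕ → ℕ} {x : ℝ} (h : IsInfContFractOf a x) :
    ⌊x⁻¹⌋ = a 0 := by
  rw [Int.floor_eq_iff]
  have h1 := h.tail.pos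
  have h2 := h.tail.lt_one
  push_cast
  constructor <;> linarith

theorem IsInfContFractOf.eq_partQuot {a : ℕ → ℕ} {x : ℝ} (h : IsInfContFractOf a x) :
    a = partQuot x := by
  funext n
  induction n generalizing a x with
  | zero =>
    rw [partQuot, Function.iterate_zero, id, ← Int.floor_toNat, h.floor_inv, Int.toNat_natCast]
  | succ n ih =>
    rw [partQuot_succ, Int.fract, h.floor_inv, Int.cast_natCast]
    exact ih h.tail

/-- Euclidean descent: the tail of the expansion of `s / t` has value `(t - a 0 * s) / s`, with
denominator `s < t`. -/
theorem not_isInfContFractOf_div (t : ℕ) (s : ℤ) (a : ℕ → ℕ) :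
    ¬ IsInfContFractOf a ((s : ℝ) / t) := by
  induction t using Nat.strong_induction_on generalizing s a with
  | _ t ih =>
    intro h
    have h0 := h.pos
    have ht : (0 : ℝ) < t := by
      rcases Nat.eq_zero_or_pos t with rfl | ht
      · simp at h0
      · exact_mod_cast ht
    have hs : (0 : ℝ) < s := by rwa [lt_div_iff₀ ht, zero_mul] at h0
    have hst : (s : ℝ) < t := (div_lt_one ht).1 h.lt_one
    obtain ⟨s, rfl⟩ := Int.eq_ofNat_of_zero_le (by exact_mod_cast hs.le : (0 : ℤ) ≤ s)
    refine ih s (by exact_mod_cast hst) (t - a 0 * s) (fun i => a (i + 1)) ?_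
    convert h.tail using 1
    rw [Int.cast_natCast] at hs ⊢
    push_cast
    field_simp

theorem IsInfContFractOf.irrational {a : ℕ → ℕ} {x : ℝ} (h : IsInfContFractOf a x) :
    Irrational x := by
  rintro ⟨r, rfl⟩
  refine not_isInfContFractOf_div r.den r.num a ?_
  rwa [← Rat.cast_def]

end ContinuedFractions

/-! ### The Trott set is `G_δ` -/

section GDelta

variable {b : ℕ}

/-- The concatenation of the digit strings of a sequence of natural numbers, as a sequence of
digits. -/
def concatFin (hb : 2 ≤ b) (a : ℕ → ℕ) (k : ℕ) : Fin b := ⟨concatDigit b a k, concatDigit_lt hb a k⟩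

theorem isConcatExpansionOf_iff (hb : 2 ≤ b) {a : ℕ → ℕ} {x : ℝ} :
    IsConcatExpansionOf b a x ↔ x = Real.ofDigits (concatFin hb a) := by
  constructor
  · rintro ⟨d, hd, rfl⟩
    congr
    funext k
    exact Fin.ext (hd k)
  · rintro rfl
    exact ⟨_, fun _ => rfl, rfl⟩

theorem continuous_concatFin (hb : 2 ≤ b) : Continuous (concatFin hb) := by
  refine continuous_pi fun k => IsLocallyConstant.continuous ?_
  rw [IsLocallyConstant.iff_eventually_eq]
  intro a
  have h : ∀ᶠ a' in 𝓝 a, ∀ i ∈ Finset.range (k + 1), a' i = a i := by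
    rw [eventually_all_finset]
    intro i _
    have hi : Continuous fun a' : ℕ → ℕ => a' i := continuous_apply i
    filter_upwards [((isOpen_discrete {a i}).preimage hi).mem_nhds rfl] with a' ha' using ha'
  filter_upwards [h] with a' ha'
  refine Fin.ext ?_
  simp only [concatFin, concatDigit, concatPrefix]
  congr 1
  rw [List.flatMap_def, List.flatMap_def]
  congr 1
  refine List.map_congr_left fun i hi => ?_
  rw [ha' i (by simpa using hi)]

theorem Irrational.eventually_floor_eq {y : ℝ} (hy : Irrational y) :
    ∀ᶠ z in 𝓝 y, ⌊z⌋ = ⌊y⌋ := by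
  have h1 : (⌊y⌋ : ℝ) < y := lt_of_le_of_ne (Int.floor_le y) (hy.ne_int _).symm
  filter_upwards [Ioo_mem_nhds h1 (Int.lt_floor_add_one y)] with z hz
  exact Int.floor_eq_iff.2 ⟨hz.1.le, hz.2⟩

theorem continuous_partQuot : Continuous fun x : {x : ℝ // Irrational x} => partQuot x := by
  have hinv : Continuous fun x : {x : ℝ // Irrational x} => (x : ℝ)⁻¹ :=
    continuous_subtype_val.inv₀ fun x => x.2.ne_zero
  refine continuous_pi fun n => ?_
  induction n with
  | zero =>
    refine IsLocallyConstant.continuous ((IsLocallyConstant.iff_eventually_eq _).2 fun x => ?_)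
    filter_upwards [hinv.continuousAt.eventually
      (irrational_inv_iff.2 x.2).eventually_floor_eq] with y hy
    simp only [partQuot, Function.iterate_zero, id, ← Int.floor_toNat, hy]
  | succ n ih =>
    have hg : Continuous fun x : {x : ℝ // Irrational x} =>
        (⟨Int.fract (x : ℝ)⁻¹, irrational_fract_inv x.2⟩ : {x : ℝ // Irrational x}) := by
      refine Continuous.subtype_mk (continuous_iff_continuousAt.2 fun x => ?_) _
      refine ContinuousAt.comp (f := fun x : {x : ℝ // Irrational x} => (x : ℝ)⁻¹)
        (continuousAt_fract ?_) hinv.continuousAt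
      exact (irrational_inv_iff.2 x.2).ne_int _
    simp only [partQuot_succ]
    exact ih.comp hg

theorem trottSet_eq (hb : 2 ≤ b) : trottSet b = {x | Irrational x} ∩ (Set.Ioo 0 1 ∩
    {x | x = Real.ofDigits (concatFin hb (partQuot x))}) := by
  ext x
  constructor
  · rintro ⟨a, ha, hd⟩
    rw [isConcatExpansionOf_iff hb, ha.eq_partQuot] at hd
    exact ⟨ha.irrational, ⟨ha.pos, ha.lt_one⟩, hd⟩
  · rintro ⟨h1, h2, h3⟩
    exact ⟨partQuot x, isInfContFractOf_partQuot h1 h2, (isConcatExpansionOf_iff hb).2 h3⟩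

theorem isGδ_trottSet (hb : 2 ≤ b) : IsGδ (trottSet b) := by
  have h : IsClosed {x : {x : ℝ // Irrational x} |
      (x : ℝ) = Real.ofDigits (concatFin hb (partQuot x))} :=
    isClosed_eq continuous_subtype_val
      (Real.continuous_ofDigits.comp ((continuous_concatFin hb).comp continuous_partQuot))
  obtain ⟨C, hC, hC'⟩ := isClosed_induced_iff.1 h
  have heq : trottSet b = {x | Irrational x} ∩ (Set.Ioo 0 1 ∩ C) := by
    rw [trottSet_eq hb]
    ext x
    refine and_congr_right fun hx => and_congr_right fun _ => ?_
    exact (Set.ext_iff.1 hC' ⟨x, hx⟩).symm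
  rw [heq]
  exact IsGδ.setOfPred_irrational.inter (isOpen_Ioo.isGδ.inter hC.isGδ)

end GDelta

/-! ### Reducing `G_δ` sets to a tree of compact sets -/

section CompleteGDelta

theorem IsOpen.exists_iUnion_isClopen {Y : Type*} [TopologicalSpace Y]
    [SecondCountableTopology Y]
    (hY : TopologicalSpace.IsTopologicalBasis {s : Set Y | IsClopen s}) {U : Set Y}
    (hU : IsOpen U) : ∃ C : ℕ → Set Y, (∀ i, IsClopen (C i)) ∧ U = ⋃ i, C i := by
  obtain ⟨S, hS, rfl⟩ := hY.open_eq_sUnion hU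
  obtain ⟨T, hT, hTS, hTU⟩ :=
    TopologicalSpace.isOpen_sUnion_countable S fun s hs => (hS hs).isOpen
  obtain ⟨C, hC⟩ := (hT.insert ∅).exists_eq_range (Set.insert_nonempty _ _)
  refine ⟨C, fun i => ?_, ?_⟩
  · have : C i ∈ insert ∅ T := hC ▸ Set.mem_range_self i
    rcases this with h | h
    · rw [h]
      exact isClopen_empty
    · exact hS (hTS h)
  · rw [← hTU, ← Set.sUnion_range, ← hC, Set.sUnion_insert, Set.empty_union]

variable {S : Type*}

/-- The branch of a tree with root `s₀` that is given by the child indices `m`. -/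
def branch (child : S → ℕ → S) (s₀ : S) (m : ℕ → ℕ) : ℕ → S
  | 0 => s₀
  | n + 1 => child (branch child s₀ m n) (m n)

/-- A scheme of compact sets `I s` indexed by the nodes of the tree of finite sequences of natural
numbers, in which the sets belonging to the children of `s` converge to a point `v s` outside `T`
and the sets along every infinite branch shrink to a point of `T`, reduces every `G_δ` set in a
zero-dimensional Polish space to `T`. -/
theorem isCompleteGDelta_of_scheme {T : Set ℝ} (hT : IsGδ T) (child : S → ℕ → S) (s₀ : S)
    (v : S → ℝ) (I : S → Set ℝ) (hI : ∀ s, IsCompact (I s)) (hvT : ∀ s, v s ∉ T)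
    (hvI : ∀ s, v s ∈ I s) (hsub : ∀ s m, I (child s m) ⊆ I s)
    (hclose : ∀ s (m : ℕ), ∀ x ∈ I (child s m), |x - v s| ≤ 1 / ((m : ℝ) + 1))
    (hdiam : ∀ m (n : ℕ), ∀ x ∈ I (branch child s₀ m n), ∀ y ∈ I (branch child s₀ m n),
      |x - y| ≤ 1 / ((n : ℝ) + 1))
    (hlim : ∀ m x, (∀ n, x ∈ I (branch child s₀ m n)) → x ∈ T) : IsCompleteGDelta T := by
  refine ⟨hT, fun Y _ _ hY B hB => ?_⟩
  obtain ⟨U, hU, rfl⟩ := isGδ_iff_eq_iInter_nat.1 hB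
  choose C hC hUC using fun n => (hU n).exists_iUnion_isClopen hY
  classical
  -- The index of the first clopen piece of `U n` containing `y`. For `y ∉ U n` it is the default
  -- `0`, which is harmless: `f y` is constrained only up to the first exit.
  let μ : Y → ℕ → ℕ := fun y n => sInf {i | y ∈ C n i}
  let path : Y → ℕ → S := fun y => branch child s₀ (μ y)
  have hanti : ∀ y, Antitone fun n => I (path y n) := fun y =>
    antitone_nat_of_succ_le fun n => hsub _ _
  -- The image of `y` follows its branch as long as `y ∈ U n`, and stops at `v` of the node where
  -- `y` first leaves.
  have hex : ∀ y, ∃ x, (∀ n, (∀ i < n, y ∈ U i) → x ∈ I (path y n)) ∧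
      ∀ n, (∀ i < n, y ∈ U i) → y ∉ U n → x = v (path y n) := by
    intro y
    by_cases hy : ∃ n, y ∉ U n
    · have hmin : ∀ i < Nat.find hy, y ∈ U i := fun i hi => not_not.1 (Nat.find_min hy hi)
      refine ⟨v (path y (Nat.find hy)), fun n hn => ?_, fun n hn hn' => ?_⟩
      · have : n ≤ Nat.find hy := by
          by_contra! hc
          exact Nat.find_spec hy (hn _ hc)
        exact hanti y this (hvI _)
      · rw [(Nat.find_eq_iff hy).2 ⟨hn', fun i hi => not_not.2 (hn i hi)⟩]
    · push Not at hy
      obtain ⟨x, hx⟩ := IsCompact.nonempty_iInter_of_sequence_nonempty_isCompact_isClosed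
        (fun n => I (path y n)) (fun n => hsub _ _) (fun n => ⟨_, hvI _⟩) (hI _)
        fun n => (hI _).isClosed
      exact ⟨x, fun n _ => Set.mem_iInter.1 hx n, fun n _ h => absurd (hy n) h⟩
  choose f hf hf' using hex
  have hCloc : ∀ n i y, ∀ᶠ z in 𝓝 y, (z ∈ C n i ↔ y ∈ C n i) := by
    intro n i y
    by_cases h : y ∈ C n i
    · filter_upwards [(hC n i).isOpen.mem_nhds h] with z hz using iff_of_true hz h
    · filter_upwards [(hC n i).compl.isOpen.mem_nhds h] with z hz using iff_of_false hz h
  have hμ : ∀ n y, y ∈ U n → ∀ᶠ z in 𝓝 y, z ∈ U n ∧ μ z n = μ y n := by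
    intro n y hy
    have hne : {i | y ∈ C n i}.Nonempty := by
      rw [hUC n] at hy
      exact Set.mem_iUnion.1 hy
    have hmem : y ∈ C n (μ y n) := Nat.sInf_mem hne
    have hall : ∀ᶠ z in 𝓝 y, ∀ i ∈ Finset.range (μ y n + 1), (z ∈ C n i ↔ y ∈ C n i) :=
      (eventually_all_finset _).2 fun i _ => hCloc n i y
    filter_upwards [(hU n).mem_nhds hy, hall] with z hz hz'
    refine ⟨hz, le_antisymm (Nat.sInf_le ((hz' _ (by simp)).2 hmem)) ?_⟩
    have hzne : {i | z ∈ C n i}.Nonempty := ⟨_, (hz' _ (by simp)).2 hmem⟩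
    have hzmem : z ∈ C n (μ z n) := Nat.sInf_mem hzne
    by_contra! hc
    exact Nat.notMem_of_lt_sInf hc ((hz' _ (Finset.mem_range.2 (by lia))).1 hzmem)
  have hpath : ∀ n y, (∀ i < n, y ∈ U i) →
      ∀ᶠ z in 𝓝 y, (∀ i < n, z ∈ U i) ∧ path z n = path y n := by
    intro n y
    induction n with
    | zero => exact fun _ => Eventually.of_forall fun z => ⟨by simp, rfl⟩
    | succ n ih =>
      intro hy
      filter_upwards [ih fun i hi => hy i (by lia), hμ n y (hy n (by lia))] with z h1 h2
      refine ⟨fun i hi => ?_, ?_⟩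
      · rcases Nat.lt_succ_iff_lt_or_eq.1 hi with h | rfl
        · exact h1.1 i h
        · exact h2.1
      · change child (path z n) (μ z n) = child (path y n) (μ y n)
        rw [h1.2, h2.2]
  refine ⟨f, continuous_iff_continuousAt.2 fun y => Metric.tendsto_nhds.2 fun ε hε => ?_, ?_⟩
  · obtain ⟨M, hM⟩ := exists_nat_one_div_lt hε
    by_cases hy : ∃ n, y ∉ U n
    · have hmin : ∀ i < Nat.find hy, y ∈ U i := fun i hi => not_not.1 (Nat.find_min hy hi)
      have hspec := Nat.find_spec hy
      set n := Nat.find hy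
      -- Near an exit point, any `z` still in `U n` lies in none of the first `M` pieces. It
      -- therefore enters a child of index at least `M`, whose set is close to `v`.
      have hnot : ∀ᶠ z in 𝓝 y, ∀ i ∈ Finset.range M, z ∉ C n i := by
        refine (eventually_all_finset _).2 fun i _ => ?_
        filter_upwards [hCloc n i y] with z hz
        rw [hz]
        exact fun h => hspec (by rw [hUC n]; exact Set.mem_iUnion.2 ⟨i, h⟩)
      filter_upwards [hpath n y hmin, hnot] with z hz hz'
      rw [hf' y n hmin hspec, Real.dist_eq]
      by_cases hzU : z ∈ U n
      · have h1 := hf z (n + 1) fun i hi => by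
          rcases Nat.lt_succ_iff_lt_or_eq.1 hi with h | rfl
          · exact hz.1 i h
          · exact hzU
        have h2 : |f z - v (path z n)| ≤ 1 / ((μ z n : ℝ) + 1) := hclose _ _ _ h1
        have hne : {i | z ∈ C n i}.Nonempty := by
          rw [hUC n] at hzU
          exact Set.mem_iUnion.1 hzU
        have h3 : M ≤ μ z n := by
          by_contra! hc
          exact hz' _ (Finset.mem_range.2 hc) (Nat.sInf_mem hne)
        have h4 : 1 / ((μ z n : ℝ) + 1) ≤ 1 / ((M : ℝ) + 1) := by gcongr
        rw [← hz.2]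
        linarith
      · rw [hf' z n hz.1 hzU, hz.2, sub_self, abs_zero]
        exact hε
    · push Not at hy
      filter_upwards [hpath M y fun i _ => hy i] with z hz
      rw [Real.dist_eq]
      have h1 := hf z M hz.1
      rw [hz.2] at h1
      exact (hdiam _ _ _ h1 _ (hf y M fun i _ => hy i)).trans_lt hM
  · ext y
    rw [Set.mem_preimage, Set.mem_iInter]
    constructor
    · intro h
      by_contra! hy
      have hmin : ∀ i < Nat.find hy, y ∈ U i := fun i hi => not_not.1 (Nat.find_min hy hi)
      rw [hf' y _ hmin (Nat.find_spec hy)] at h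
      exact hvT _ h
    · exact fun hy => hlim (μ y) _ fun n => hf y n fun i _ => hy i

theorem dense_eventually_eq (c : Bool) : Dense {x : ℕ → Bool | ∀ᶠ n in atTop, x n = c} := by
  intro x
  have h : Tendsto (fun k : ℕ => fun n => if n < k then x n else c) atTop (𝓝 x) := by
    refine tendsto_pi_nhds.2 fun n => tendsto_const_nhds.congr' ?_
    filter_upwards [eventually_gt_atTop n] with k hk
    rw [if_pos hk]
  refine mem_closure_of_tendsto h (Eventually.of_forall fun k => ?_)
  filter_upwards [eventually_ge_atTop k] with n hn
  rw [if_neg (by lia)]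

/-- In Cantor space the sequences with infinitely many `true` form a dense `G_δ` with dense
complement. If `A` were `F_σ`, this complement would be `G_δ` too, and two disjoint dense `G_δ` sets
contradict Baire. -/
theorem IsCompleteGDelta.not_isFSigma {X : Type*} [TopologicalSpace X] {A : Set X}
    (hA : IsCompleteGDelta A) : ¬ IsFSigma A := by
  rintro ⟨F, hF, rfl⟩
  have hB : IsGδ {x : ℕ → Bool | ∃ᶠ n in atTop, x n = true} := by
    have : {x : ℕ → Bool | ∃ᶠ n in atTop, x n = true} =
        ⋂ m : ℕ, ⋃ n ≥ m, {x : ℕ → Bool | x n = true} := by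
      ext x
      simp [frequently_atTop]
    rw [this]
    refine IsGδ.iInter fun m => (isOpen_biUnion fun n _ => ?_).isGδ
    exact (isOpen_discrete {true}).preimage (continuous_apply (A := fun _ : ℕ => Bool) n)
  have : PolishSpace (ℕ → Bool) := {}
  obtain ⟨f, hf, hfB⟩ := hA.2 (ℕ → Bool) isTopologicalBasis_isClopen _ hB
  have hdense : Dense {x : ℕ → Bool | ∃ᶠ n in atTop, x n = true} :=
    (dense_eventually_eq true).mono fun x hx => hx.frequently
  have hdense' : Dense {x : ℕ → Bool | ∃ᶠ n in atTop, x n = true}ᶜ := by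
    refine (dense_eventually_eq false).mono fun x hx => ?_
    rw [Set.mem_compl_iff, Set.mem_ofPred_eq, not_frequently]
    exact hx.mono fun n hn => by rw [hn]; decide
  have hG : IsGδ {x : ℕ → Bool | ∃ᶠ n in atTop, x n = true}ᶜ := by
    rw [← hfB, Set.preimage_iUnion, Set.compl_iUnion]
    exact IsGδ.iInter fun n => ((hF n).preimage hf).isOpen_compl.isGδ
  have := (hdense.inter_of_Gδ hB hG hdense').nonempty
  rw [Set.inter_compl_self] at this
  exact Set.not_nonempty_empty this

end CompleteGDelta

/-! ### Branches of good prefixes and the conclusion -/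

section Final

theorem exists_seq_of_list_chain (l₀ : List ℕ) (x : ℕ → ℕ) (L : ℕ → List ℕ) (h₀ : L 0 = l₀)
    (hL : ∀ n, L (n + 1) = L n ++ [x n]) :
    ∃ a : ℕ → ℕ, ∀ n, (List.range (l₀.length + n)).map a = L n := by
  refine ⟨fun i => if h : i < l₀.length then l₀[i] else x (i - l₀.length), fun n => ?_⟩
  induction n with
  | zero =>
    rw [h₀]
    refine List.ext_getElem (by simp) fun i h1 h2 => ?_
    simp [h2]
  | succ n ih =>
    rw [← add_assoc, map_range_succ, ih, hL]
    simp

/-- The convergents and the number with the concatenated digits lie in the same shrinking intervals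
as `x`, so both expansions have value `x`. -/
theorem isTrott_of_forall_mem_digitInterval {b : ℕ} (hb : 2 ≤ b) {a : ℕ → ℕ} {N : ℕ} {x : ℝ}
    (ha : ∀ n ≥ N, GoodPrefix b ((List.range n).map a))
    (hx : ∀ n ≥ N, x ∈ digitInterval b ((List.range n).map a)) : IsTrott b x := by
  have hpos : ∀ n, 0 < a n := fun n =>
    (ha (N + n + 1) (by lia)).pos _ (List.mem_map.2 ⟨n, List.mem_range.2 (by lia), rfl⟩)
  have hbr : (1 : ℝ) < b := by exact_mod_cast hb
  have hbound : ∀ n ≥ N, ∀ y ∈ digitInterval b ((List.range n).map a),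
      |y - x| ≤ (1 / (b : ℝ)) ^ n := by
    intro n hn y hy
    refine (abs_sub_le_of_mem_digitInterval hy (hx n hn)).trans ?_
    rw [one_div_pow]
    refine one_div_le_one_div_of_le (by positivity) (pow_le_pow_right₀ hbr.le ?_)
    simpa using le_prefixData_N (b := b) (ha n hn).pos
  have hlim : Tendsto (fun n : ℕ => (1 / (b : ℝ)) ^ n) atTop (𝓝 0) :=
    tendsto_pow_atTop_nhds_zero_of_lt_one (by positivity) ((div_lt_one (by linarith)).2 hbr)
  refine ⟨a, ⟨hpos, ?_⟩, (isConcatExpansionOf_iff hb).2 ?_⟩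
  · refine tendsto_iff_dist_tendsto_zero.2 ?_
    refine squeeze_zero' (Eventually.of_forall fun _ => dist_nonneg) ?_ hlim
    filter_upwards [eventually_ge_atTop N] with n hn
    rw [infContFract_convs b, Real.dist_eq]
    exact hbound n hn _ ((ha n hn).prefixValue_mem hb)
  · have h := ge_of_tendsto hlim (b := |Real.ofDigits (concatFin hb a) - x|) (by
      filter_upwards [eventually_ge_atTop N] with n hn
      exact hbound n hn _ (ofDigits_mem_digitInterval hb hpos (fun _ => rfl) n))
    exact (sub_eq_zero.1 (abs_nonpos_iff.1 h)).symm

theorem isCompleteGDelta_trottSet {b : ℕ} (hb : b ∈ Gam) : IsCompleteGDelta (trottSet b) := by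
  obtain ⟨hb, l₀, hl₀⟩ := exists_goodPrefix hb
  choose c hc hc' using fun (s : {l // GoodPrefix b l}) m => s.2.exists_concat hb m
  let child : {l // GoodPrefix b l} → ℕ → {l // GoodPrefix b l} := fun s m => ⟨_, hc s m⟩
  have hlen : ∀ m n, l₀.length + n = (branch child ⟨l₀, hl₀⟩ m n).1.length := by
    intro m n
    induction n with
    | zero => rfl
    | succ n ih => simp [branch, child, ← ih, add_assoc]
  refine isCompleteGDelta_of_scheme (isGδ_trottSet hb) child ⟨l₀, hl₀⟩
    (fun s => prefixValue b s.1) (fun s => digitInterval b s.1) (fun s => isCompact_Icc) ?_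
    (fun s => s.2.prefixValue_mem hb) (fun s m => digitInterval_concat_subset hb _ _) hc' ?_ ?_
  · rintro s ⟨a, ha, -⟩
    exact ha.irrational ⟨(prefixData b s.1).p / (prefixData b s.1).q, by
      push_cast [prefixValue]
      rfl⟩
  · intro m n x hx y hy
    refine (abs_sub_le_of_mem_digitInterval hx hy).trans ?_
    refine one_div_le_one_div_of_le (by positivity) ?_
    have h1 := le_prefixData_N (b := b) (branch child ⟨l₀, hl₀⟩ m n).2.pos
    rw [← hlen] at h1
    have h2 := Nat.lt_pow_self (n := (prefixData b (branch child ⟨l₀, hl₀⟩ m n).1).N)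
      (by lia : 1 < b)
    exact_mod_cast (by lia : n + 1 ≤ b ^ (prefixData b (branch child ⟨l₀, hl₀⟩ m n).1).N)
  · intro m x hx
    obtain ⟨a, ha⟩ := exists_seq_of_list_chain l₀
      (fun n => c (branch child ⟨l₀, hl₀⟩ m n) (m n))
      (fun n => (branch child ⟨l₀, hl₀⟩ m n).1) rfl (fun n => rfl)
    refine isTrott_of_forall_mem_digitInterval hb (a := a) (N := l₀.length) ?_ ?_ <;>
    · intro n hn
      obtain ⟨n, rfl⟩ := Nat.exists_eq_add_of_le hn
      rw [ha]
      first | exact (branch child ⟨l₀, hl₀⟩ m n).2 | exact hx n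

end Final

theorem theorem2 (b : ℕ) (hb : b ∈ Gam) :
    IsCompleteGDelta (trottSet b) ∧ IsGδ (trottSet b) ∧ ¬ IsFSigma (trottSet b) :=
  have h := isCompleteGDelta_trottSet hb
  ⟨h, h.1, h.not_isFSigma⟩
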